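/- **Conventions.** A represented space is a set $X$ with a surjective partial map $\delta_X:\subseteq\mathbb{N}^{\mathbb{N}}\to X$; any $p$ with $\delta_X(p)=x$ is called a name of $x$. A problem $f:\subseteq X\rightrightarrows Y$ is a partial multi-valued map between represented spaces. A partial function $F:\subseteq\mathbb{N}^{\mathbb{N}}\to\mathbb{N}^{\mathbb{N}}$ is a realizer of $f$, written $F\vdash f$, if $F$ maps every name $p$ of an $x\in\mathrm{dom}(f)$ to a name of some element of $f(x)$. Such an $F$ is computable if some Turing machine with one-way output tape computes $F(p)$ from every $p\in\mathrm{dom}(F)$; limit computable if $F=\lim\circ K$ for some computable $K:\subseteq\mathbb{N}^{\mathbb{N}}\to\mathbb{N}^{\mathbb{N}}$, where $\lim\langle p_0,p_1,\dots\rangle=\lim_{n\to\infty}p_n$; and computable with finitely many mind changes if some Turing machine, which is allowed to revise its output, computes $F(p)$ from every $p\in\mathrm{dom}(F)$ while revising its output only finitely often on each such $p$. A problem has one of these properties if it has a realizer with this property. Weihrauch reducibility $f\leq_{\mathrm W}g$ means that there are computable $H,K:\subseteq\mathbb{N}^{\mathbb{N}}\to\mathbb{N}^{\mathbb{N}}$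 such that $H\langle\mathrm{id},GK\rangle\vdash f$ for all $G\vdash g$; and $f<_{\mathrm W}g$ means $f\leq_{\mathrm W}g$ and $g\not\leq_{\mathrm W}f$. The completion of a represented space $X$ is $\overline{X}=X\cup\{\bot\}$ with $\bot\notin X$, where $p$ is a name of $x\in X$ if the sequence $p-1$ (delete all zeros of $p$ and subtract $1$ from all other entries) is infinite and a name of $x$ in $X$, and every other $p\in\mathbb{N}^{\mathbb{N}}$ is a name of $\bot$. For a problem $f:\subseteq X\rightrightarrows Y$, the completion $\overline{f}:\overline{X}\rightrightarrows\overline{Y}$ and the totalization $\mathsf{T}f:X\rightrightarrows Y$ are given by $\overline{f}(x)=\mathsf{T}f(x)=f(x)$ for $x\in\mathrm{dom}(f)$, and by $\overline{f}(x)=\overline{Y}$ and $\mathsf{T}f(x)=Y$, respectively, for all other $x$. Let $\mathbb{N}$ be represented by $p\mapsto p(0)$, and let $\mathcal{A}_-(\mathbb{N})$ be the space of closed subsets of $\mathbb{N}$ (that is, all subsets), represented by $p\mapsto\mathbb{N}\setminus\bigcup_{j}B_{p(j)}$, where $B_{\langle n,\langle i,k\rangle\rangle}$ is the open ball in $\mathbb{N}$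 with center $n$ and radius $\frac{i}{k+1}$. The choice problem $\mathsf{C}_{\mathbb{N}}:\subseteq\mathcal{A}_-(\mathbb{N})\rightrightarrows\mathbb{N}$, $A\mapsto A$, has domain $\{A: A\neq\emptyset\}$. **Statement.** The completion $\overline{\mathsf{C}_{\mathbb{N}}}$ is limit computable, but it is not computable with finitely many mind changes, and $\mathsf{T}\mathsf{C}_{\mathbb{N}}$ is not limit computable. Moreover, $\mathsf{C}_{\mathbb{N}}<_{\mathrm W}\overline{\mathsf{C}_{\mathbb{N}}}<_{\mathrm W}\mathsf{T}\mathsf{C}_{\mathbb{N}}$. -/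

import Mathlib

namespace Weihrauch

/-- Baire space `ℕ^ℕ`, with the product topology of the discrete topology on `ℕ`. -/
abbrev Baire : Type := ℕ → ℕ

/-! ### Represented spaces -/

/-- A represented space: a type `X` with a surjective partial map `δ` from Baire space onto `X`. -/
class RepresentedSpace (X : Type*) where
  /-- the representation of `X` -/
  δ : Baire →. X
  surj : ∀ x : X, ∃ p : Baire, x ∈ δ p

open RepresentedSpace (δ)

/-- A problem `f :⊆ X ⇉ Y`: a partial multi-valued map between represented spaces. The value `f x`
is the set of admitted solutions; it is empty exactly when `x` is not in the domain. -/
abbrev Problem (X Y : Type*) : Type _ := X → Set Y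

namespace Problem

/-- The domain of a problem. -/
def dom {X Y : Type*} (f : Problem X Y) : Set X := {x | (f x).Nonempty}

/-- The totalization `T f`: every element is a solution for an instance outside of the domain. -/
noncomputable def totalization {X Y : Type*} (f : Problem X Y) : Problem X Y :=
  open Classical in fun x => if x ∈ f.dom then f x else Set.univ

end Problem

/-! ### Completions -/

/-- `p - 1`: delete all zeros of `p` and subtract `1` from the remaining entries. It is a point of
Baire space iff infinitely many entries of `p` are different from zero. -/
noncomputable def predSeq : Baire →. Baire := fun p =>
  ⟨{n | p n ≠ 0}.Infinite, fun _ k => p (Nat.nth (fun n => p n ≠ 0) k) - 1⟩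

/-- The precompletion of the representation of `X`: a name of `x` is a sequence `p` such that
`p - 1` is a name of `x`. -/
noncomputable def precompletion (X : Type*) [RepresentedSpace X] : Baire →. X := fun p =>
  (predSeq p).bind δ

theorem predSeq_succ (p : Baire) : p ∈ predSeq (fun n => p n + 1) := by
  refine ⟨?_, ?_⟩
  · have h : {n : ℕ | p n + 1 ≠ 0} = Set.univ := by simp
    change {n : ℕ | p n + 1 ≠ 0}.Infinite
    rw [h]
    exact Set.infinite_univ
  · funext k
    have h : (fun n => p n + 1 ≠ 0) = fun _ => True := by simp
    simp [predSeq, Nat.nth_true]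

/-- The underlying set of the completion: `X` together with a new point `⊥`, given by `none`. -/
abbrev Completion (X : Type*) : Type _ := Option X

/-- The completion of a represented space: a name of `x ∈ X` is a name with respect to the
precompletion, and every other sequence is a name of `⊥`. -/
noncomputable instance {X : Type*} [RepresentedSpace X] : RepresentedSpace (Completion X) where
  δ := open Classical in fun p => Part.some (precompletion X p).toOption
  surj := by
    classical
    rintro (_ | x)
    · refine ⟨fun _ => 0, ?_⟩
      have h : ¬ (precompletion X fun _ => 0).Dom := by
        rintro ⟨h, -⟩
        simp [predSeq] at h
      rw [Part.mem_some_iff, Part.toOption, dif_neg h]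
    · obtain ⟨p, hp⟩ := RepresentedSpace.surj x
      refine ⟨fun n => p n + 1, ?_⟩
      have h : x ∈ precompletion X (fun n => p n + 1) := Part.mem_bind (predSeq_succ p) hp
      rw [Part.mem_some_iff, eq_comm, ← Option.mem_def, Part.mem_toOption]
      exact h

/-- The completion of a problem `f`: it equals `f` on the domain of `f`, and every element of the
completion of `Y` is a solution for every other instance, in particular for `⊥`. -/
noncomputable def Problem.completion {X Y : Type*} (f : Problem X Y) :
    Problem (Completion X) (Completion Y)
  | some x => open Classical in if x ∈ f.dom then some '' f x else Set.univ
  | none => Set.univ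

/-! ### Computability on Baire space -/

/-- The finite prefix `p(0) … p(n-1)` of `p`. -/
def pref (p : Baire) (n : ℕ) : List ℕ := (List.range n).map p

/-- A partial function on Baire space is computable if it is approximated by a computable function
on words that is monotone for the prefix order: for `p ∈ dom(F)` the words `φ (p(0) … p(n-1))`,
the content of the one-way output tape after `n` symbols of the input were read, grow to `F p`. -/
def ComputableFun (F : Baire →. Baire) : Prop :=
  ∃ φ : List ℕ → List ℕ, Computable φ ∧
    (∀ u v : List ℕ, u <+: v → φ u <+: φ v) ∧
    ∀ p q : Baire, q ∈ F p → ∀ k : ℕ, ∃ n : ℕ, (φ (pref p n))[k]? = some (q k)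

/-- Computability with finitely many mind changes, for machines which are allowed to revise their
output. Here `φ (p(0) … p(n-1))` is the content of the output tape after `n` steps (in which at
most the first `n` symbols of the input were read). A step is a mind change if it does not just
extend the output. On every input `p ∈ dom(F)` there are only finitely many mind changes, and the
output converges to `F p`. -/
def FiniteMindChangeFun (F : Baire →. Baire) : Prop :=
  ∃ φ : List ℕ → List ℕ, Computable φ ∧
    ∀ p q : Baire, q ∈ F p →
      {n : ℕ | ¬ φ (pref p n) <+: φ (pref p (n + 1))}.Finite ∧
      ∀ k : ℕ, ∀ᶠ n in Filter.atTop, (φ (pref p n))[k]? = some (q k)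

/-- The limit map `⟨p₀, p₁, p₂, …⟩ ↦ lim pₙ`, where `⟨p₀, p₁, p₂, …⟩ ⟨n, k⟩ = pₙ k` and the limit
is taken in Baire space. -/
noncomputable def limFun : Baire →. Baire := fun p =>
  ⟨∃ q : Baire, Filter.Tendsto (fun n : ℕ => (fun k : ℕ => p (Nat.pair n k) : Baire))
    Filter.atTop (nhds q), fun h => h.choose⟩

/-- A partial function on Baire space is limit computable if it is of the form `lim ∘ K` with a
computable `K`. -/
def LimitComputableFun (F : Baire →. Baire) : Prop :=
  ∃ K : Baire →. Baire, ComputableFun K ∧ F = limFun.comp K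

/-! ### Realizers and Weihrauch reducibility -/

/-- `F` is a realizer of `f`: it maps every name of an instance `x ∈ dom(f)` to a name of a
solution of `x`. -/
def Realizes {X Y : Type*} [RepresentedSpace X] [RepresentedSpace Y]
    (F : Baire →. Baire) (f : Problem X Y) : Prop :=
  ∀ (p : Baire) (x : X), x ∈ δ p → x ∈ f.dom → ∃ q ∈ F p, ∃ y ∈ (δ q : Part Y), y ∈ f x

/-- A problem is limit computable if it has a limit computable realizer. -/
def LimitComputable {X Y : Type*} [RepresentedSpace X] [RepresentedSpace Y]
    (f : Problem X Y) : Prop :=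
  ∃ F : Baire →. Baire, LimitComputableFun F ∧ Realizes F f

/-- A problem is computable with finitely many mind changes if it has a realizer that is. -/
def FiniteMindChangeComputable {X Y : Type*} [RepresentedSpace X] [RepresentedSpace Y]
    (f : Problem X Y) : Prop :=
  ∃ F : Baire →. Baire, FiniteMindChangeFun F ∧ Realizes F f

/-- The pairing `⟨p, q⟩` of two sequences: `p` at the even and `q` at the odd positions. -/
def pairSeq (p q : Baire) : Baire := fun n => if n % 2 = 0 then p (n / 2) else q (n / 2)

/-- Weihrauch reducibility `f ≤_W g`: there are computable `H`, `K` such that `H ⟨id, G K⟩` is a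
realizer of `f` for every realizer `G` of `g`. -/
def WeihrauchLE {X Y U V : Type*} [RepresentedSpace X] [RepresentedSpace Y]
    [RepresentedSpace U] [RepresentedSpace V] (f : Problem X Y) (g : Problem U V) : Prop :=
  ∃ H K : Baire →. Baire, ComputableFun H ∧ ComputableFun K ∧
    ∀ G : Baire →. Baire, Realizes G g →
      Realizes (fun p => ((K p).bind G).bind fun q => H (pairSeq p q)) f

/-- Strict Weihrauch reducibility `f <_W g`. -/
def WeihrauchLT {X Y U V : Type*} [RepresentedSpace X] [RepresentedSpace Y]
    [RepresentedSpace U] [RepresentedSpace V] (f : Problem X Y) (g : Problem U V) : Prop :=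
  WeihrauchLE f g ∧ ¬ WeihrauchLE g f

/-! ### Choice on the natural numbers -/

/-- The representation `p ↦ p(0)` of the natural numbers. -/
instance : RepresentedSpace ℕ where
  δ := fun p => Part.some (p 0)
  surj := fun n => ⟨fun _ => n, by simp⟩

/-- The basic open ball `B_⟨n,⟨i,k⟩⟩` with center `n` and radius `i / (k + 1)` in the metric
space `ℕ`. -/
noncomputable def basicBall (m : ℕ) : Set ℕ :=
  Metric.ball m.unpair.1 ((m.unpair.2.unpair.1 : ℝ) / ((m.unpair.2.unpair.2 : ℝ) + 1))

/-- The closed subset of `ℕ` with negative information `p`: the complement of the union of the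
basic balls `B_p(0), B_p(1), …`. -/
noncomputable def closedOfName (p : Baire) : TopologicalSpace.Closeds ℕ :=
  ⟨(⋃ n, basicBall (p n))ᶜ, isClosed_discrete _⟩

/-- The represented space `A_-(ℕ)` of closed subsets of `ℕ` with negative information. -/
noncomputable instance : RepresentedSpace (TopologicalSpace.Closeds ℕ) where
  δ := fun p => Part.some (closedOfName p)
  surj := by
    classical
    intro A
    refine ⟨fun n => if n ∈ A then 0 else Nat.pair n (Nat.pair 1 0), ?_⟩
    rw [Part.mem_some_iff, ← SetLike.coe_set_eq]
    have key : ∀ n, basicBall (if n ∈ A then 0 else Nat.pair n (Nat.pair 1 0)) =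
        if n ∈ A then ∅ else {n} := by
      intro n
      split_ifs
      · have h0 : Nat.unpair 0 = (0, 0) := by decide
        simp [basicBall, h0]
      · ext m
        simp only [basicBall, Nat.unpair_pair, Metric.mem_ball, Set.mem_singleton_iff,
          Nat.dist_eq]
        norm_num
        constructor
        · intro h
          rw [abs_lt] at h
          have h1 : (m : ℝ) < n + 1 := by linarith
          have h2 : (n : ℝ) < m + 1 := by linarith
          have h3 : m < n + 1 := by exact_mod_cast h1
          have h4 : n < m + 1 := by exact_mod_cast h2
          omega
        · rintro rfl
          simp
    ext m
    simp only [closedOfName, TopologicalSpace.Closeds.coe_mk, key]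
    by_cases hm : m ∈ A
    · simp only [SetLike.mem_coe, hm, Set.mem_compl_iff, Set.mem_iUnion, true_iff, not_exists]
      intro i
      by_cases hi : i ∈ A
      · simp [hi]
      · simp only [hi, if_false, Set.mem_singleton_iff]
        rintro rfl
        exact hi hm
    · simp only [SetLike.mem_coe, hm, Set.mem_compl_iff, Set.mem_iUnion, false_iff, not_not]
      exact ⟨m, by simp [hm]⟩

/-- Choice on the natural numbers `C_ℕ :⊆ A_-(ℕ) ⇉ ℕ, A ↦ A`, with the non-empty sets as its
domain. -/
def choiceNat : Problem (TopologicalSpace.Closeds ℕ) ℕ := fun A => (A : Set ℕ)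

end Weihrauch

/-!
Everything negative rests on one fact, `false_of_pointwise_limit`: no sequence of locally constant
functions `h n : ℕ^ℕ → ℕ` is eventually constant at *every* point `p` and has a limit in the set
named by `p` whenever this set is non-empty. By the Baire category theorem such a limit would be
locally constant on some cylinder. There, a name with finite information has its solution determined
by a finite prefix, and the prefix can be continued by removing this solution from the set. The argument
is topological: of computable functions only the approximation on finite prefixes matters, in
particular their continuity (`ComputableFun.continuous`).

Such a sequence arises from
* a realizer of the completion with finitely many mind changes: read off the number named by the
  first non-zero symbol of the output tape (`exists_eventually_firstNonzero_eq`). The realizer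
  has to be total, so the number stabilizes everywhere, even on names of the empty set;
* a reduction of the completion to choice: such a reduction maps every name to a name of a non-empty
  set, for which the least number that is not yet excluded stabilizes;
* a limit computable realizer of the totalization, or a reduction of the totalization to a limit
  computable problem: here a number is named by its first symbol, which stabilizes in every limit.

The completion is limit computable, since the name of the current guess `g` may be preceded by `g`
zeros (`delayedName`). If the guesses stabilize, so do these names, and if they tend to infinity, as
happens for the empty set, then the names still converge, to the name `0 0 0 …` of `⊥`. The same
realization is impossible for the totalization, as `ℕ` has no such point `⊥`. The two positive
reductions translate names between `p`, `p + 1` and `p - 1`; the code `0` of an empty ball stands in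
for the symbol `0`, which carries no information.
-/

namespace Weihrauch

open Filter Topology
open RepresentedSpace (δ)

/-! ### Prefixes and computable functions on Baire space -/

@[simp] theorem length_pref (p : Baire) (n : ℕ) : (pref p n).length = n := by simp [pref]

theorem pref_succ (p : Baire) (n : ℕ) : pref p (n + 1) = pref p n ++ [p n] := by
  simp [pref, List.range_succ]

theorem getElem?_pref (p : Baire) {n i : ℕ} (h : i < n) : (pref p n)[i]? = some (p i) := by
  simp [pref, h]

theorem pref_prefix_pref (p : Baire) {m n : ℕ} (h : m ≤ n) : pref p m <+: pref p n := by
  induction n, h using Nat.le_induction with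
  | base => exact List.prefix_rfl
  | succ n _ ih => exact ih.trans (pref_succ p n ▸ List.prefix_append _ _)

theorem pref_congr {p q : Baire} {n : ℕ} (h : ∀ i < n, p i = q i) : pref p n = pref q n := by
  simp only [pref, List.map_inj_left, List.mem_range]
  exact h

theorem take_pref (p : Baire) {m n : ℕ} (h : m ≤ n) : (pref p n).take m = pref p m := by
  rw [pref, ← List.map_take, List.take_range, min_eq_left h, pref]

theorem map_pref (f : ℕ → ℕ) (p : Baire) (n : ℕ) :
    (pref p n).map f = pref (fun i => f (p i)) n := by
  simp [pref]

theorem getElem?_of_prefix {u v : List ℕ} (h : u <+: v) {i a : ℕ} (hu : u[i]? = some a) :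
    v[i]? = some a := by
  obtain ⟨t, rfl⟩ := h
  obtain ⟨hi, -⟩ := List.getElem?_eq_some_iff.1 hu
  rwa [List.getElem?_append_left hi]

theorem computableFun_map {f : ℕ → ℕ} (hf : Primrec f) :
    ComputableFun fun p => Part.some fun n => f (p n) := by
  refine ⟨List.map f, (Primrec.list_map Primrec.id (hf.comp Primrec.snd).to₂).to_comp,
    fun u v h => h.map f, fun p q hq k => ⟨k + 1, ?_⟩⟩
  rw [Part.mem_some_iff] at hq
  subst hq
  rw [map_pref, getElem?_pref _ k.lt_succ_self]

/-- The partial function that waits until the test `c` accepts a prefix of the input with a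
value `m`, and then returns the constant sequence `m`. -/
noncomputable def searchFun (c : List ℕ → Option ℕ) : Baire →. Baire := fun p =>
  ⟨∃ m n, c (pref p n) = some m, fun h _ => h.choose⟩

theorem mem_searchFun {c : List ℕ → Option ℕ}
    (hmono : ∀ u v m, u <+: v → c u = some m → c v = some m) {p : Baire} {m n : ℕ}
    (h : c (pref p n) = some m) : (fun _ => m) ∈ searchFun c p := by
  have hd : ∃ m n, c (pref p n) = some m := ⟨m, n, h⟩
  refine ⟨hd, ?_⟩
  obtain ⟨n', hn'⟩ := hd.choose_spec
  have h1 := hmono _ _ _ (pref_prefix_pref p (le_max_left n n')) h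
  have h2 := hmono _ _ _ (pref_prefix_pref p (le_max_right n n')) hn'
  funext _
  exact Option.some.inj (h2.symm.trans h1)

theorem computableFun_searchFun {c : List ℕ → Option ℕ} (hc : Primrec c)
    (hmono : ∀ u v m, u <+: v → c u = some m → c v = some m) :
    ComputableFun (searchFun c) := by
  refine ⟨fun u => (c u).elim [] fun m => u.map fun _ => m, ?_, ?_, ?_⟩
  · have h : Primrec fun u : List ℕ => Option.casesOn (motive := fun _ => List ℕ) (c u) []
        fun m => u.map fun _ => m :=
      Primrec.option_casesOn hc (Primrec.const [])
        (Primrec.list_map Primrec.fst (Primrec.snd.comp Primrec.fst).to₂).to₂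
    refine (h.of_eq fun u => ?_).to_comp
    cases c u <;> rfl
  · intro u v huv
    beta_reduce
    cases hu : c u with
    | none => exact List.nil_prefix
    | some m =>
      rw [hmono u v m huv hu]
      exact huv.map _
  · rintro p q ⟨⟨m, n, h⟩, rfl⟩ k
    have hval : (searchFun c p).get ⟨m, n, h⟩ = fun _ => m :=
      Part.mem_unique ⟨_, rfl⟩ (mem_searchFun hmono h)
    refine ⟨max n (k + 1), ?_⟩
    beta_reduce
    rw [hval, hmono _ _ _ (pref_prefix_pref p (le_max_left n (k + 1))) h]
    simp [pref]

/-! ### Continuity -/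

theorem exists_cylinder_of_mem_nhds {s : Set Baire} {x : Baire} (hs : s ∈ 𝓝 x) :
    ∃ n, ∀ p : Baire, (∀ i < n, p i = x i) → p ∈ s := by
  let : ∀ _ : ℕ, TopologicalSpace ℕ := fun _ => ⊥
  obtain ⟨t, ⟨y, n, rfl⟩, hx, ht⟩ :=
    (PiNat.isTopologicalBasis_cylinders (fun _ : ℕ => ℕ)).mem_nhds_iff.1 hs
  refine ⟨n, fun p hp => ht fun i hi => ?_⟩
  rw [hp i hi]
  exact hx i hi

theorem eventually_pref_eq (x : Baire) (n : ℕ) : ∀ᶠ p in 𝓝 x, pref p n = pref x n := by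
  have h : ∀ i ∈ Set.Iio n, ∀ᶠ p : Baire in 𝓝 x, p i = x i := fun i _ =>
    (continuous_apply i).continuousAt.eventually_mem ((isOpen_discrete {x i}).mem_nhds rfl)
  filter_upwards [(Filter.eventually_all_finite (Set.finite_Iio n)).2 h] with p hp
  exact pref_congr hp

theorem isLocallyConstant_pref {f : Baire → Baire} (hf : Continuous f) (n : ℕ) :
    IsLocallyConstant fun p => pref (f p) n :=
  (IsLocallyConstant.iff_eventually_eq _).2 fun x =>
    hf.continuousAt.eventually (eventually_pref_eq (f x) n)

/-- A symbol that a monotone approximation has written is final. -/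
theorem getElem?_eq_of_mem {φ : List ℕ → List ℕ} (hmono : ∀ u v, u <+: v → φ u <+: φ v)
    {p q : Baire} (hq : ∀ k, ∃ n, (φ (pref p n))[k]? = some (q k)) {n k a : ℕ}
    (h : (φ (pref p n))[k]? = some a) : a = q k := by
  obtain ⟨n', hn'⟩ := hq k
  have h1 := getElem?_of_prefix (hmono _ _ (pref_prefix_pref p (le_max_left n n'))) h
  have h2 := getElem?_of_prefix (hmono _ _ (pref_prefix_pref p (le_max_right n n'))) hn'
  exact Option.some.inj (h1.symm.trans h2)

/-- A computable function is continuous along every continuous family of points of its domain. -/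
theorem ComputableFun.continuous {F : Baire →. Baire} (hF : ComputableFun F) {f f' : Baire → Baire}
    (hf : Continuous f) (h : ∀ p, f' p ∈ F (f p)) : Continuous f' := by
  obtain ⟨φ, -, hmono, hφ⟩ := hF
  refine continuous_pi fun k => (IsLocallyConstant.iff_continuous _).1
    ((IsLocallyConstant.iff_eventually_eq _).2 fun x => ?_)
  obtain ⟨n, hn⟩ := hφ _ _ (h x) k
  filter_upwards [(isLocallyConstant_pref hf n).eventually_eq x] with p hp
  rw [← hp] at hn
  exact (getElem?_eq_of_mem hmono (hφ _ _ (h p)) hn).symm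

theorem continuous_pairSeq {f g : Baire → Baire} (hf : Continuous f) (hg : Continuous g) :
    Continuous fun p => pairSeq (f p) (g p) := by
  refine continuous_pi fun n => ?_
  unfold pairSeq
  split_ifs
  · exact (continuous_apply (n / 2)).comp hf
  · exact (continuous_apply (n / 2)).comp hg

/-! ### Negative information on sets of natural numbers -/

/-- The decision procedure for membership of `m` in the basic ball with code `x`. -/
def excludes (x m : ℕ) : Bool :=
  decide ((x.unpair.1 - m + (m - x.unpair.1)) * (x.unpair.2.unpair.2 + 1) < x.unpair.2.unpair.1)

theorem mem_basicBall {x m : ℕ} : m ∈ basicBall x ↔ excludes x m = true := by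
  have hd : dist m x.unpair.1 = ((x.unpair.1 - m + (m - x.unpair.1) : ℕ) : ℝ) := by
    rw [Nat.dist_eq]
    rcases le_total m x.unpair.1 with h | h
    · rw [Nat.sub_eq_zero_of_le h, add_zero, Nat.cast_sub h, abs_sub_comm,
        abs_of_nonneg (sub_nonneg.2 (Nat.cast_le.2 h))]
    · rw [Nat.sub_eq_zero_of_le h, zero_add, Nat.cast_sub h,
        abs_of_nonneg (sub_nonneg.2 (Nat.cast_le.2 h))]
  rw [basicBall, Metric.mem_ball, hd, lt_div_iff₀ (by positivity), excludes, decide_eq_true_eq]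
  norm_cast

theorem primrec₂_excludes : Primrec₂ excludes := by
  have hx1 : Primrec fun z : ℕ × ℕ => z.1.unpair.1 :=
    Primrec.fst.comp (Primrec.unpair.comp Primrec.fst)
  have hx2 : Primrec fun z : ℕ × ℕ => z.1.unpair.2.unpair :=
    Primrec.unpair.comp (Primrec.snd.comp (Primrec.unpair.comp Primrec.fst))
  have hl : Primrec fun z : ℕ × ℕ =>
      (z.1.unpair.1 - z.2 + (z.2 - z.1.unpair.1)) * (z.1.unpair.2.unpair.2 + 1) :=
    Primrec.nat_mul.comp
      (Primrec.nat_add.comp (Primrec.nat_sub.comp hx1 Primrec.snd)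
        (Primrec.nat_sub.comp Primrec.snd hx1))
      (Primrec.succ.comp (Primrec.snd.comp hx2))
  exact (Primrec.nat_lt.comp hl (Primrec.fst.comp hx2)).decide

theorem mem_closedOfName {p : Baire} {m : ℕ} :
    m ∈ closedOfName p ↔ ∀ n, excludes (p n) m = false := by
  change m ∈ (⋃ n, basicBall (p n))ᶜ ↔ _
  simp [mem_basicBall]

@[simp] theorem excludes_zero (m : ℕ) : excludes 0 m = false := by
  simp [excludes]

theorem excludes_pair_one (a m : ℕ) :
    excludes (Nat.pair a (Nat.pair 1 0)) m = true ↔ m = a := by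
  simp only [excludes, Nat.unpair_pair, decide_eq_true_eq]
  omega

theorem eq_false_of_excludes_of_le {x m : ℕ} (h : x.unpair.1 + x.unpair.2.unpair.1 ≤ m) :
    excludes x m = false := by
  rw [excludes, decide_eq_false_iff_not, not_lt]
  calc x.unpair.2.unpair.1 ≤ x.unpair.1 - m + (m - x.unpair.1) := by omega
    _ ≤ _ := Nat.le_mul_of_pos_right _ (Nat.succ_pos _)

/-- Finitely many basic balls do not cover `ℕ`. -/
theorem nonempty_closedOfName_of_eventually_zero {p : Baire} {n : ℕ} (h : ∀ i, n ≤ i → p i = 0) :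
    ∃ m, m ∈ closedOfName p := by
  refine ⟨∑ i ∈ Finset.range n, ((p i).unpair.1 + (p i).unpair.2.unpair.1), ?_⟩
  rw [mem_closedOfName]
  intro i
  rcases lt_or_ge i n with hi | hi
  · exact eq_false_of_excludes_of_le (Finset.single_le_sum
      (f := fun i => (p i).unpair.1 + (p i).unpair.2.unpair.1)
      (fun _ _ => Nat.zero_le _) (Finset.mem_range.2 hi))
  · rw [h i hi, excludes_zero]

/-- The least number below the length of `u` that is not excluded by the balls listed in `u`, and
the length of `u` if there is none. -/
def guess (u : List ℕ) : ℕ :=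
  (List.range u.length).findIdx fun m => decide (∀ x ∈ u, excludes x m = false)

theorem primrec_guess : Primrec guess := by
  have hR : PrimrecRel fun x m : ℕ => excludes x m = false :=
    Primrec.eq.comp₂ primrec₂_excludes (Primrec₂.const false)
  exact Primrec.list_findIdx (Primrec.list_range.comp Primrec.list_length) hR.forall_mem_list.decide

theorem le_guess_pref {p : Baire} {n b : ℕ} (hb : b < n)
    (h : ∀ j < b, ∃ i < n, excludes (p i) j = true) : b ≤ guess (pref p n) := by
  refine List.le_findIdx_of_not (by simpa using hb) fun j hj => ?_
  obtain ⟨i, hi, hx⟩ := h j hj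
  simp only [List.getElem_range, decide_eq_false_iff_not, not_forall]
  exact ⟨p i, List.mem_map_of_mem (List.mem_range.2 hi), by simp [hx]⟩

theorem guess_pref_le {p : Baire} {n a : ℕ} (ha : a ∈ closedOfName p) : guess (pref p n) ≤ a := by
  by_contra! hlt
  have h := List.not_of_lt_findIdx hlt
  simp only [List.getElem_range, decide_eq_false_iff_not] at h
  refine h fun x hx => ?_
  obtain ⟨i, -, rfl⟩ := List.mem_map.1 hx
  exact mem_closedOfName.1 ha i

theorem eventually_le_guess {p : Baire} {b : ℕ} (h : ∀ j < b, j ∉ closedOfName p) :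
    ∀ᶠ n in atTop, b ≤ guess (pref p n) := by
  have h' : ∀ j ∈ Set.Iio b, ∀ᶠ n in atTop, ∃ i < n, excludes (p i) j = true := by
    intro j hj
    have := h j hj
    simp only [mem_closedOfName, not_forall, Bool.not_eq_false] at this
    obtain ⟨i, hi⟩ := this
    filter_upwards [eventually_gt_atTop i] with n hn using ⟨i, hn, hi⟩
  filter_upwards [(Filter.eventually_all_finite (Set.finite_Iio b)).2 h', eventually_gt_atTop b]
    with n hn hb using le_guess_pref hb hn

/-- On a name of a non-empty set the guesses stabilize at its least element. -/
theorem exists_eventually_guess_eq {p : Baire} (h : ∃ m, m ∈ closedOfName p) :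
    ∃ a ∈ closedOfName p, ∀ᶠ n in atTop, guess (pref p n) = a := by
  classical
  refine ⟨Nat.find h, Nat.find_spec h, ?_⟩
  filter_upwards [eventually_le_guess fun j hj => Nat.find_min h hj] with n hn
  exact le_antisymm (guess_pref_le (Nat.find_spec h)) hn

/-- Choice on `ℕ` has no solution that is the everywhere existing pointwise limit of locally
constant functions. By the Baire category theorem, the limit would be locally constant on some
cylinder. A name in this cylinder with finite information has a non-empty set and its solution `a`
is determined by a prefix, which can be continued by the information `a ∉ A`. -/
theorem false_of_pointwise_limit (h : ℕ → Baire → ℕ) (hc : ∀ n, IsLocallyConstant (h n))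
    (hlim : ∀ p, ∃ a, (∀ᶠ n in atTop, h n p = a) ∧
      ((∃ m, m ∈ closedOfName p) → a ∈ closedOfName p)) : False := by
  obtain ⟨N, x, hx⟩ : ∃ N, (interior {p | ∀ n, N ≤ n → h n p = h N p}).Nonempty := by
    refine nonempty_interior_of_iUnion_of_closed (fun N => ?_) (Set.eq_univ_of_forall fun p => ?_)
    · simp only [Set.ofPred_forall]
      exact isClosed_iInter fun n => isClosed_iInter fun _ =>
        isClosed_eq (hc n).continuous (hc N).continuous
    · obtain ⟨a, ha, -⟩ := hlim p
      obtain ⟨N, hN⟩ := eventually_atTop.1 ha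
      exact Set.mem_iUnion.2 ⟨N, fun n hn => (hN n hn).trans (hN N le_rfl).symm⟩
  obtain ⟨l, hl⟩ := exists_cylinder_of_mem_nhds (mem_interior_iff_mem_nhds.1 hx)
  let p₁ : Baire := fun i => if i < l then x i else 0
  obtain ⟨l', hl'⟩ := exists_cylinder_of_mem_nhds ((hc N).eventually_eq p₁)
  let p₂ : Baire := fun i =>
    if i < max l l' then p₁ i
    else if i = max l l' then Nat.pair (h N p₁) (Nat.pair 1 0) else 0
  have h1 : ∀ n, N ≤ n → h n p₂ = h N p₂ := hl p₂ fun i hi => by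
    simp only [p₂, p₁]
    rw [if_pos (by omega), if_pos hi]
  have h2 : h N p₂ = h N p₁ := hl' p₂ fun i hi => by
    simp only [p₂]
    rw [if_pos (by omega)]
  obtain ⟨a, ha, hA⟩ := hlim p₂
  obtain ⟨n, hn, rfl⟩ := ((eventually_ge_atTop N).and ha).exists
  have hmem := hA (nonempty_closedOfName_of_eventually_zero (n := max l l' + 1) fun i hi => by
    simp only [p₂]
    rw [if_neg (by omega), if_neg (by omega)])
  rw [h1 n hn, h2, mem_closedOfName] at hmem
  have hex : excludes (p₂ (max l l')) (h N p₁) = true := by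
    simp only [p₂, lt_irrefl, if_false, if_true, excludes_pair_one]
  exact Bool.noConfusion (hex.symm.trans (hmem _))

/-! ### Names in completions -/

theorem some_mem_δ {X : Type*} [RepresentedSpace X] {q : Baire} {x : X} :
    some x ∈ (δ q : Part (Completion X)) ↔ ∃ r ∈ predSeq q, x ∈ (δ r : Part X) := by
  classical
  change some x ∈ Part.some (precompletion X q).toOption ↔ _
  rw [Part.mem_some_iff, eq_comm, ← Option.mem_def, Part.mem_toOption]
  exact Part.mem_bind_iff

theorem exists_mem_δ_completion {X : Type*} [RepresentedSpace X] (q : Baire) :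
    ∃ x, x ∈ (δ q : Part (Completion X)) :=
  ⟨_, Part.mem_some _⟩

theorem mem_δ_nat {q : Baire} {a : ℕ} : a ∈ (δ q : Part ℕ) ↔ a = q 0 :=
  Part.mem_some_iff

theorem mem_δ_closeds {p : Baire} {A : TopologicalSpace.Closeds ℕ} :
    A ∈ (δ p : Part (TopologicalSpace.Closeds ℕ)) ↔ A = closedOfName p :=
  Part.mem_some_iff

/-- Replacing the zeros of `p` by the code `0` of an empty ball has the same effect on the named set
as deleting them. -/
theorem closedOfName_of_mem_predSeq {p r : Baire} (h : r ∈ predSeq p) :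
    closedOfName (fun n => p n - 1) = closedOfName r := by
  obtain ⟨hinf, rfl⟩ := h
  ext m
  change m ∈ closedOfName _ ↔ m ∈ closedOfName _
  rw [mem_closedOfName, mem_closedOfName]
  refine ⟨fun h k => h _, fun h n => ?_⟩
  rcases eq_or_ne (p n) 0 with hn | hn
  · simp [hn]
  · have := h (Nat.count (fun n => p n ≠ 0) n)
    simpa only [predSeq, Nat.nth_count (p := fun n => p n ≠ 0) hn] using this

/-- The number named by `q` in the completion of `ℕ` is given by the first non-zero entry of `q`. -/
theorem eq_of_some_mem_δ_nat {q : Baire} {y : ℕ} (h : some y ∈ (δ q : Part (Completion ℕ))) :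
    ∃ k, q k ≠ 0 ∧ (∀ j < k, q j = 0) ∧ y = q k - 1 := by
  obtain ⟨r, ⟨hinf, rfl⟩, hy⟩ := some_mem_δ.1 h
  refine ⟨Nat.nth (fun n => q n ≠ 0) 0, Nat.nth_mem_of_infinite hinf 0, fun j hj => ?_,
    mem_δ_nat.1 hy⟩
  by_contra hne
  rw [Nat.nth_zero] at hj
  exact (Nat.sInf_le (show j ∈ Set.ofPred fun n => q n ≠ 0 from hne)).not_gt hj

/-- A name of `g` in the completion of `ℕ`, delayed so that it tends to a name of `⊥` for `g → ∞`. -/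
def delayedName (g : ℕ) : Baire := fun k => if k < g then 0 else g + 1

theorem some_mem_δ_delayedName (g : ℕ) : some g ∈ (δ (delayedName g) : Part (Completion ℕ)) := by
  have hinf : {n | delayedName g n ≠ 0}.Infinite := by
    refine (Set.Ici_infinite g).mono fun n hn => ?_
    simpa [delayedName] using hn
  refine some_mem_δ.2 ⟨_, ⟨hinf, rfl⟩, mem_δ_nat.2 ?_⟩
  have h := Nat.nth_mem_of_infinite hinf 0
  simp only [predSeq]
  unfold delayedName at h ⊢
  split_ifs at h ⊢ <;> simp_all

/-- The first non-zero entry of a word. -/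
def firstNonzero (u : List ℕ) : Option ℕ := u[u.findIdx fun x => decide (x ≠ 0)]?

theorem primrec_firstNonzero : Primrec firstNonzero :=
  Primrec.list_getElem?.comp Primrec.id
    (Primrec.list_findIdx Primrec.id
      ((Primrec.eq.comp Primrec.snd (Primrec.const 0)).not.decide).to₂)

theorem firstNonzero_mono {u v : List ℕ} {m : ℕ} (huv : u <+: v) (h : firstNonzero u = some m) :
    firstNonzero v = some m := by
  rw [firstNonzero, huv.findIdx_eq_of_findIdx_lt_length (List.getElem?_eq_some_iff.1 h).1]
  exact getElem?_of_prefix huv h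

theorem firstNonzero_eq {u : List ℕ} {q : Baire} {k : ℕ} (hk : q k ≠ 0) (hlt : ∀ j < k, q j = 0)
    (hu : ∀ j ≤ k, u[j]? = some (q j)) : firstNonzero u = some (q k) := by
  obtain ⟨hkl, hk'⟩ := List.getElem?_eq_some_iff.1 (hu k le_rfl)
  have hi : u.findIdx (fun x => decide (x ≠ 0)) = k := by
    refine (List.findIdx_eq hkl).2 ⟨by simpa [hk'] using hk, fun j hj => ?_⟩
    have := (List.getElem?_eq_some_iff.1 (hu j hj.le)).2
    simp [this, hlt j hj]
  rw [firstNonzero, hi, hu k le_rfl]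

theorem firstNonzero_eq_none {u : List ℕ} (h : ∀ x ∈ u, x = 0) : firstNonzero u = none := by
  rw [firstNonzero, List.findIdx_eq_length_of_false (by simpa using h)]
  simp

/-- If the content `u n` of an output tape converges to `q` with finitely many mind changes, then
the number read off from it stabilizes, and the limit is the number named by `q`, if any. -/
theorem exists_eventually_firstNonzero_eq {u : ℕ → List ℕ} {q : Baire}
    (hmono : ∀ᶠ n in atTop, u n <+: u (n + 1))
    (hq : ∀ k, ∀ᶠ n in atTop, (u n)[k]? = some (q k)) :
    ∃ a, (∀ᶠ n in atTop, (firstNonzero (u n)).getD 0 - 1 = a) ∧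
      ∀ y, some y ∈ (δ q : Part (Completion ℕ)) → a = y := by
  by_cases h0 : ∃ k, q k ≠ 0 ∧ ∀ j < k, q j = 0
  · obtain ⟨k, hk, hlt⟩ := h0
    refine ⟨q k - 1, ?_, fun y hy => ?_⟩
    · filter_upwards [(Filter.eventually_all_finite (Set.finite_Iic k)).2 fun j _ => hq j] with n hn
      rw [firstNonzero_eq hk hlt hn, Option.getD_some]
    · obtain ⟨k', hk', hlt', rfl⟩ := eq_of_some_mem_δ_nat hy
      rcases lt_trichotomy k k' with h | rfl | h
      · exact absurd (hlt' k h) hk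
      · rfl
      · exact absurd (hlt k' h) hk'
  · have hz : ∀ k, q k = 0 := fun k => by
      induction k using Nat.strong_induction_on with
      | _ k ih => exact by_contra fun hk => h0 ⟨k, hk, ih⟩
    refine ⟨0, ?_, fun y hy => ?_⟩
    · obtain ⟨N, hN⟩ := eventually_atTop.1 hmono
      have hpre : ∀ m n, N ≤ m → m ≤ n → u m <+: u n := fun m n hm hmn => by
        induction n, hmn using Nat.le_induction with
        | base => exact List.prefix_rfl
        | succ n hmn ih => exact ih.trans (hN n (hm.trans hmn))
      filter_upwards [eventually_ge_atTop N] with m hm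
      rw [firstNonzero_eq_none fun x hx => ?_, Option.getD_none]
      obtain ⟨k, hk⟩ := List.mem_iff_getElem?.1 hx
      obtain ⟨n, hn, hmn⟩ := ((hq k).and (eventually_ge_atTop m)).exists
      have := getElem?_of_prefix (hpre m n hm hmn) hk
      rw [hn, hz k] at this
      exact (Option.some.inj this).symm
    · obtain ⟨k, hk, -⟩ := eq_of_some_mem_δ_nat hy
      exact absurd (hz k) hk

/-! ### Realizers of the completion and of the totalization of choice -/

theorem completion_mem_dom (x : Completion (TopologicalSpace.Closeds ℕ)) :
    x ∈ choiceNat.completion.dom := by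
  classical
  rcases x with _ | A
  · exact ⟨none, trivial⟩
  · change (if A ∈ choiceNat.dom then some '' choiceNat A else Set.univ).Nonempty
    split_ifs with h
    · exact h.image _
    · exact ⟨none, trivial⟩

theorem mem_completion_some {A : TopologicalSpace.Closeds ℕ} {y : Completion ℕ} :
    y ∈ choiceNat.completion (some A) ↔ ((∃ m, m ∈ A) → ∃ a ∈ A, some a = y) := by
  classical
  change y ∈ (if A ∈ choiceNat.dom then some '' choiceNat A else Set.univ) ↔ _
  split_ifs with h
  · exact ⟨fun hy _ => hy, fun hy => hy h⟩
  · exact ⟨fun _ h' => absurd h' h, fun _ => trivial⟩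

theorem mem_totalization {A : TopologicalSpace.Closeds ℕ} {y : ℕ} :
    y ∈ choiceNat.totalization A ↔ ((∃ m, m ∈ A) → y ∈ A) := by
  classical
  change y ∈ (if A ∈ choiceNat.dom then choiceNat A else Set.univ) ↔ _
  split_ifs with h
  · exact ⟨fun hy _ => hy, fun hy => hy h⟩
  · exact ⟨fun _ h' => absurd h' h, fun _ => trivial⟩

theorem totalization_mem_dom (A : TopologicalSpace.Closeds ℕ) :
    A ∈ choiceNat.totalization.dom := by
  by_cases h : ∃ m, m ∈ A
  · exact h.imp fun m hm => mem_totalization.2 fun _ => hm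
  · exact ⟨0, mem_totalization.2 fun h' => absurd h' h⟩

/-- Every sequence of the form `p + 1` is a name of a proper instance of the completion. -/
theorem Realizes.of_completion {F : Baire →. Baire} (hF : Realizes F choiceNat.completion)
    (p : Baire) : ∃ q ∈ F fun n => p n + 1, (∃ m, m ∈ closedOfName p) →
      ∃ a ∈ closedOfName p, some a ∈ (δ q : Part (Completion ℕ)) := by
  obtain ⟨q, hq, y, hy, h⟩ := hF (fun n => p n + 1) (some (closedOfName p))
    (some_mem_δ.2 ⟨p, predSeq_succ p, mem_δ_closeds.2 rfl⟩) (completion_mem_dom _)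
  refine ⟨q, hq, fun hne => ?_⟩
  obtain ⟨a, ha, rfl⟩ := mem_completion_some.1 h hne
  exact ⟨a, ha, hy⟩

/-- For realizing the completion it suffices to treat `p` as the negative information `p - 1` with
truncated subtraction, that is, to read the symbol `0` as an empty ball. -/
theorem realizes_completion {F : Baire →. Baire}
    (hF : ∀ p, ∃ q ∈ F p, (∃ m, m ∈ closedOfName fun n => p n - 1) →
      ∃ a ∈ closedOfName fun n => p n - 1, some a ∈ (δ q : Part (Completion ℕ))) :
    Realizes F choiceNat.completion := by
  rintro p (_ | A) hp -
  · obtain ⟨q, hq, -⟩ := hF p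
    obtain ⟨y, hy⟩ := exists_mem_δ_completion (X := ℕ) q
    exact ⟨q, hq, y, hy, trivial⟩
  · obtain ⟨r, hr, hA⟩ := some_mem_δ.1 hp
    obtain rfl := mem_δ_closeds.1 hA
    rw [← closedOfName_of_mem_predSeq hr]
    obtain ⟨q, hq, h⟩ := hF p
    by_cases hne : ∃ m, m ∈ closedOfName fun n => p n - 1
    · obtain ⟨a, ha, haq⟩ := h hne
      exact ⟨q, hq, some a, haq, mem_completion_some.2 fun _ => ⟨a, ha, rfl⟩⟩
    · obtain ⟨y, hy⟩ := exists_mem_δ_completion (X := ℕ) q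
      exact ⟨q, hq, y, hy, mem_completion_some.2 fun h' => absurd h' hne⟩

theorem Realizes.of_totalization {F : Baire →. Baire} (hF : Realizes F choiceNat.totalization)
    (p : Baire) : ∃ q ∈ F p, (∃ m, m ∈ closedOfName p) → q 0 ∈ closedOfName p := by
  obtain ⟨q, hq, y, hy, h⟩ := hF p (closedOfName p) (mem_δ_closeds.2 rfl) (totalization_mem_dom _)
  obtain rfl := mem_δ_nat.1 hy
  exact ⟨q, hq, mem_totalization.1 h⟩

/-! ### The upper bound for the completion -/

theorem mem_limFun {p q : Baire} :
    q ∈ limFun p ↔ Tendsto (fun n k => p (Nat.pair n k) : ℕ → Baire) atTop (𝓝 q) := by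
  constructor
  · rintro ⟨h, rfl⟩
    exact h.choose_spec
  · intro h
    have hd : ∃ q : Baire, Tendsto (fun n k => p (Nat.pair n k) : ℕ → Baire) atTop (𝓝 q) := ⟨q, h⟩
    exact ⟨hd, tendsto_nhds_unique hd.choose_spec h⟩

/-- The sequence of sequences whose row `n` is the delayed name of the guess that is based on the
first `n` symbols of `p`, where the symbol `0` is read as the code of an empty ball. -/
def guessRows (p : Baire) : Baire := fun m =>
  delayedName (guess (pref (fun i => p i - 1) m.unpair.1)) m.unpair.2

theorem computableFun_guessRows : ComputableFun fun p => Part.some (guessRows p) := by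
  refine ⟨fun u => (List.range u.length).map fun m =>
    delayedName (guess ((u.take m.unpair.1).map Nat.pred)) m.unpair.2, ?_, ?_, ?_⟩
  · have h1 : Primrec fun z : List ℕ × ℕ => z.2.unpair := Primrec.unpair.comp Primrec.snd
    have hg : Primrec fun z : List ℕ × ℕ => guess ((z.1.take z.2.unpair.1).map Nat.pred) :=
      primrec_guess.comp (Primrec.list_map
        (Primrec.list_take.comp (Primrec.fst.comp h1) Primrec.fst)
        (Primrec.pred.comp Primrec.snd).to₂)
    have hd : Primrec fun z : List ℕ × ℕ =>
        delayedName (guess ((z.1.take z.2.unpair.1).map Nat.pred)) z.2.unpair.2 :=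
      Primrec.ite (Primrec.nat_lt.comp (Primrec.snd.comp h1) hg) (Primrec.const 0)
        (Primrec.succ.comp hg)
    exact (Primrec.list_map (Primrec.list_range.comp Primrec.list_length) hd.to₂).to_comp
  · rintro u _ ⟨t, rfl⟩
    beta_reduce
    rw [List.length_append, List.range_add, List.map_append]
    refine ⟨_, congrArg (· ++ _) ?_⟩
    refine List.map_congr_left fun m hm => ?_
    rw [List.take_append_of_le_length
      ((Nat.unpair_left_le m).trans (List.mem_range.1 hm).le)]
  · intro p q hq k
    rw [Part.mem_some_iff] at hq
    subst hq
    refine ⟨k + 1, ?_⟩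
    simp [guessRows, map_pref, take_pref _ ((Nat.unpair_left_le k).trans k.le_succ)]

theorem limitComputable_completion : LimitComputable choiceNat.completion := by
  refine ⟨limFun.comp fun p => Part.some (guessRows p),
    ⟨_, computableFun_guessRows, rfl⟩, realizes_completion fun p => ?_⟩
  have hrow (n : ℕ) : (fun k => guessRows p (Nat.pair n k)) =
      delayedName (guess (pref (fun i => p i - 1) n)) := by
    funext k
    simp [guessRows]
  have hF : limFun.comp (fun p => Part.some (guessRows p) : Baire →. Baire) p =
      limFun (guessRows p) := Part.bind_some _ _
  simp only [hF, mem_limFun]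
  by_cases hne : ∃ m, m ∈ closedOfName fun n => p n - 1
  · obtain ⟨a, ha, hev⟩ := exists_eventually_guess_eq hne
    exact ⟨delayedName a, tendsto_const_nhds.congr' (hev.mono fun n hn => by rw [← hn, ← hrow]),
      fun _ => ⟨a, ha, some_mem_δ_delayedName a⟩⟩
  · -- The guesses tend to infinity, and the delayed names to the name `0 0 0 …` of `⊥`.
    refine ⟨fun _ => 0, tendsto_pi_nhds.2 fun k => ?_, fun h => absurd h hne⟩
    refine tendsto_const_nhds.congr' ?_
    filter_upwards [eventually_le_guess (b := k + 1) fun j _ hj => hne ⟨j, hj⟩] with n hn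
    exact ((congrFun (hrow n) k).trans (if_pos hn)).symm

/-! ### The reductions -/

/-- The entries of a word at the odd positions, that is, the second component of a pair. -/
def odds (u : List ℕ) : List ℕ := (List.range (u.length / 2)).map fun i => u.getD (2 * i + 1) 0

theorem primrec_odds : Primrec odds :=
  Primrec.list_map
    (Primrec.list_range.comp (Primrec.nat_div.comp Primrec.list_length (Primrec.const 2)))
    ((Primrec.list_getD 0).comp Primrec.fst
      (Primrec.succ.comp (Primrec.nat_mul.comp (Primrec.const 2) Primrec.snd))).to₂

theorem odds_mono {u v : List ℕ} (h : u <+: v) : odds u <+: odds v := by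
  obtain ⟨t, rfl⟩ := h
  obtain ⟨d, hd⟩ := Nat.exists_eq_add_of_le
    (Nat.div_le_div_right (c := 2) (List.prefix_append u t).length_le)
  rw [odds, odds, hd, List.range_add, List.map_append]
  refine ⟨_, congrArg (· ++ _) ?_⟩
  refine List.map_congr_left fun i hi => ?_
  have := List.mem_range.1 hi
  rw [List.getD_append _ _ _ _ (by omega)]

theorem odds_pref_pairSeq (p q : Baire) (n : ℕ) : odds (pref (pairSeq p q) (2 * n)) = pref q n := by
  rw [odds, length_pref, Nat.mul_div_cancel_left n two_pos]
  refine List.map_congr_left fun i hi => ?_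
  have := List.mem_range.1 hi
  rw [List.getD_eq_getElem?_getD, getElem?_pref _ (by omega), Option.getD_some, pairSeq,
    if_neg (by omega)]
  congr 1
  omega

theorem choiceNat_le_completion : WeihrauchLE choiceNat choiceNat.completion := by
  have hmono : ∀ u v m, u <+: v → (firstNonzero (odds u)).map Nat.pred = some m →
      (firstNonzero (odds v)).map Nat.pred = some m := by
    intro u v m huv h
    obtain ⟨a, ha, rfl⟩ := Option.map_eq_some_iff.1 h
    rw [firstNonzero_mono (odds_mono huv) ha, Option.map_some]
  refine ⟨searchFun fun u => (firstNonzero (odds u)).map Nat.pred, _,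
    computableFun_searchFun (Primrec.option_map (primrec_firstNonzero.comp primrec_odds)
      (Primrec.pred.comp Primrec.snd).to₂) hmono,
    computableFun_map Primrec.succ, fun G hG p A hp hA => ?_⟩
  obtain rfl := mem_δ_closeds.1 hp
  obtain ⟨q, hq, h⟩ := hG.of_completion p
  obtain ⟨a, ha, haq⟩ := h hA
  obtain ⟨k, hk, hlt, rfl⟩ := eq_of_some_mem_δ_nat haq
  refine ⟨fun _ => q k - 1, Part.mem_bind (Part.mem_bind (Part.mem_some _) hq)
    (mem_searchFun hmono (n := 2 * (k + 1)) ?_), q k - 1, mem_δ_nat.2 rfl, ha⟩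
  rw [odds_pref_pairSeq, firstNonzero_eq hk hlt fun j hj =>
    getElem?_pref q (Nat.lt_succ_of_le hj)]
  rfl

theorem completion_le_totalization :
    WeihrauchLE choiceNat.completion choiceNat.totalization := by
  have hmono : ∀ u v m, u <+: v → (odds u)[0]?.map Nat.succ = some m →
      (odds v)[0]?.map Nat.succ = some m := by
    intro u v m huv h
    obtain ⟨a, ha, rfl⟩ := Option.map_eq_some_iff.1 h
    rw [getElem?_of_prefix (odds_mono huv) ha, Option.map_some]
  refine ⟨searchFun fun u => (odds u)[0]?.map Nat.succ, _,
    computableFun_searchFun (Primrec.option_map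
      (Primrec.list_getElem?.comp primrec_odds (Primrec.const 0))
      (Primrec.succ.comp Primrec.snd).to₂) hmono,
    computableFun_map Primrec.pred, fun G hG => realizes_completion fun p => ?_⟩
  obtain ⟨q, hq, h⟩ := hG.of_totalization fun n => p n - 1
  refine ⟨fun _ => q 0 + 1, Part.mem_bind (Part.mem_bind (Part.mem_some _) hq)
    (mem_searchFun hmono (n := 2 * 1) ?_), fun hne => ⟨q 0, h hne, ?_⟩⟩
  · rw [odds_pref_pairSeq, getElem?_pref q one_pos]
    rfl
  · exact some_mem_δ.2 ⟨_, predSeq_succ fun _ => q 0, mem_δ_nat.2 rfl⟩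

/-! ### The lower bounds -/

theorem not_finiteMindChangeComputable_completion :
    ¬ FiniteMindChangeComputable choiceNat.completion := by
  rintro ⟨F, ⟨φ, -, hφ⟩, hF⟩
  refine false_of_pointwise_limit
    (fun n p => (firstNonzero (φ (pref (fun i => p i + 1) n))).getD 0 - 1) (fun n => ?_)
    fun p => ?_
  · have hc : Continuous fun (p : Baire) (i : ℕ) => p i + 1 :=
      continuous_pi fun i => continuous_of_discreteTopology.comp (continuous_apply i)
    exact (isLocallyConstant_pref hc n).comp fun u => (firstNonzero (φ u)).getD 0 - 1
  · obtain ⟨q, hq, h⟩ := hF.of_completion p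
    obtain ⟨hfin, hlim⟩ := hφ _ q hq
    have hmono : ∀ᶠ n in atTop, φ (pref (fun i => p i + 1) n) <+:
        φ (pref (fun i => p i + 1) (n + 1)) := by
      rw [← Nat.cofinite_eq_atTop]
      exact hfin
    obtain ⟨a, ha, hval⟩ := exists_eventually_firstNonzero_eq hmono hlim
    refine ⟨a, ha, fun hne => ?_⟩
    obtain ⟨b, hb, hbq⟩ := h hne
    exact hval b hbq ▸ hb

/-- The limit of the guesses on names of non-empty sets is a realizer of choice with a minimal
domain. -/
noncomputable def guessLimit : Baire →. Baire := fun p =>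
  ⟨∃ m, m ∈ closedOfName p, fun h _ => (exists_eventually_guess_eq h).choose⟩

theorem realizes_guessLimit : Realizes guessLimit choiceNat := by
  intro p A hp hA
  obtain rfl := mem_δ_closeds.1 hp
  exact ⟨_, ⟨hA, rfl⟩, _, mem_δ_nat.2 rfl, (exists_eventually_guess_eq hA).choose_spec.1⟩

/-- A reduction would map every name to a name of a non-empty set, on which the guesses stabilize.
So the completion would be solved with finitely many mind changes, at most one for every revised
guess. -/
theorem not_completion_le_choiceNat : ¬ WeihrauchLE choiceNat.completion choiceNat := by
  rintro ⟨H, K, ⟨φ, hφc, hmono, hφ⟩, hK, hred⟩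
  have key (p : Baire) : ∃ r ∈ K fun i => p i + 1, ∃ a q, (∀ᶠ n in atTop, guess (pref r n) = a) ∧
      q ∈ H (pairSeq (fun i => p i + 1) fun _ => a) ∧ ((∃ m, m ∈ closedOfName p) →
        ∃ a ∈ closedOfName p, some a ∈ (δ q : Part (Completion ℕ))) := by
    obtain ⟨q, hq, h⟩ := (hred _ realizes_guessLimit).of_completion p
    obtain ⟨_, hs, hq⟩ := Part.mem_bind_iff.1 hq
    obtain ⟨r, hr, hne, rfl⟩ := Part.mem_bind_iff.1 hs
    exact ⟨r, hr, _, q, (exists_eventually_guess_eq hne).choose_spec.2, hq, h⟩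
  choose k hk a q ha hq h using key
  have hsucc : Continuous fun (p : Baire) (i : ℕ) => p i + 1 :=
    continuous_pi fun i => continuous_of_discreteTopology.comp (continuous_apply i)
  have hkc : Continuous k := hK.continuous hsucc hk
  refine false_of_pointwise_limit (fun n p => (firstNonzero (φ (pref (pairSeq (fun i => p i + 1)
    fun _ => guess (pref (k p) n)) n))).getD 0 - 1) (fun n => ?_) fun p => ?_
  · have hg : Continuous fun (p : Baire) (_ : ℕ) => guess (pref (k p) n) :=
      continuous_pi fun _ => ((isLocallyConstant_pref hkc n).comp guess).continuous
    exact (isLocallyConstant_pref (continuous_pairSeq hsucc hg) n).comp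
      fun u => (firstNonzero (φ u)).getD 0 - 1
  · obtain ⟨b, hb, hval⟩ := exists_eventually_firstNonzero_eq
      (u := fun n => φ (pref (pairSeq (fun i => p i + 1) fun _ => a p) n)) (q := q p)
      (Eventually.of_forall fun n => hmono _ _ (pref_prefix_pref _ n.le_succ)) fun j => by
        obtain ⟨n₀, hn₀⟩ := hφ _ _ (hq p) j
        filter_upwards [eventually_ge_atTop n₀] with n hn
        exact getElem?_of_prefix (hmono _ _ (pref_prefix_pref _ hn)) hn₀
    refine ⟨b, ?_, fun hne => ?_⟩
    · filter_upwards [hb, ha p] with n hn hn'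
      rw [hn', hn]
    · obtain ⟨c, hc, hcq⟩ := h p hne
      exact hval c hcq ▸ hc

theorem not_limitComputable_totalization : ¬ LimitComputable choiceNat.totalization := by
  rintro ⟨_, ⟨K, hK, rfl⟩, hF⟩
  have key (p : Baire) : ∃ r ∈ K p, ∃ q,
      Tendsto (fun n j => r (Nat.pair n j) : ℕ → Baire) atTop (𝓝 q) ∧
        ((∃ m, m ∈ closedOfName p) → q 0 ∈ closedOfName p) := by
    obtain ⟨q, hq, h⟩ := hF.of_totalization p
    obtain ⟨r, hr, hq⟩ := Part.mem_bind_iff.1 hq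
    exact ⟨r, hr, q, mem_limFun.1 hq, h⟩
  choose k hk q hq h using key
  have hkc : Continuous k := hK.continuous continuous_id hk
  refine false_of_pointwise_limit (fun n p => k p (Nat.pair n 0))
    (fun n => (IsLocallyConstant.iff_continuous _).2 ((continuous_apply _).comp hkc))
    fun p => ⟨q p 0, ?_, h p⟩
  have := tendsto_pi_nhds.1 (hq p) 0
  rwa [nhds_discrete, tendsto_pure] at this

/-- If the totalization of choice were reducible to a limit computable problem, the first symbol of
its solution would be the limit of the first symbols that are computed from the approximations. -/
theorem LimitComputable.not_totalization_le {X Y : Type*} [RepresentedSpace X]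
    [RepresentedSpace Y] {g : Problem X Y} (hg : LimitComputable g) :
    ¬ WeihrauchLE choiceNat.totalization g := by
  obtain ⟨_, ⟨L, hL, rfl⟩, hG⟩ := hg
  rintro ⟨H, K, ⟨φ, hφc, hmono, hφ⟩, hK, hred⟩
  have key (p : Baire) : ∃ s ∈ K p, ∃ r ∈ L s, ∃ t q,
      Tendsto (fun n j => r (Nat.pair n j) : ℕ → Baire) atTop (𝓝 t) ∧
        q ∈ H (pairSeq p t) ∧ ((∃ m, m ∈ closedOfName p) → q 0 ∈ closedOfName p) := by
    obtain ⟨q, hq, h⟩ := (hred _ hG).of_totalization p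
    obtain ⟨t, ht, hq⟩ := Part.mem_bind_iff.1 hq
    obtain ⟨s, hs, ht⟩ := Part.mem_bind_iff.1 ht
    obtain ⟨r, hr, ht⟩ := Part.mem_bind_iff.1 ht
    exact ⟨s, hs, r, hr, t, q, mem_limFun.1 ht, hq, h⟩
  choose s hs r hr t q ht hq h using key
  have hrc : Continuous r := hL.continuous (hK.continuous continuous_id hs) hr
  have hrow (n : ℕ) : Continuous fun (p : Baire) (j : ℕ) => r p (Nat.pair n j) :=
    continuous_pi fun j => (continuous_apply _).comp hrc
  refine false_of_pointwise_limit
    (fun n p => (φ (pref (pairSeq p fun j => r p (Nat.pair n j)) n))[0]?.getD 0)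
    (fun n => (isLocallyConstant_pref (continuous_pairSeq continuous_id (hrow n)) n).comp
      fun u => (φ u)[0]?.getD 0) fun p => ⟨q p 0, ?_, h p⟩
  obtain ⟨n₀, hn₀⟩ := hφ _ _ (hq p) 0
  -- Only the first `n₀` symbols of the input of `φ` matter, and these stabilize.
  have hev := (continuous_pairSeq (continuous_const (y := p)) continuous_id).continuousAt.tendsto.comp
    (ht p) |>.eventually (eventually_pref_eq _ n₀)
  filter_upwards [hev, eventually_ge_atTop n₀] with n hn hle
  have h1 : (φ (pref (pairSeq p fun j => r p (Nat.pair n j)) n₀))[0]? = some (q p 0) :=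
    (congrArg (fun u => (φ u)[0]?) hn).trans hn₀
  rw [getElem?_of_prefix (hmono _ _ (pref_prefix_pref _ hle)) h1, Option.getD_some]

end Weihrauch

theorem proposition8p2 :
    Weihrauch.LimitComputable Weihrauch.choiceNat.completion ∧
    ¬ Weihrauch.FiniteMindChangeComputable Weihrauch.choiceNat.completion ∧
    ¬ Weihrauch.LimitComputable Weihrauch.choiceNat.totalization ∧
    Weihrauch.WeihrauchLT Weihrauch.choiceNat Weihrauch.choiceNat.completion ∧
    Weihrauch.WeihrauchLT Weihrauch.choiceNat.completion Weihrauch.choiceNat.totalization :=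
  ⟨Weihrauch.limitComputable_completion, Weihrauch.not_finiteMindChangeComputable_completion,
    Weihrauch.not_limitComputable_totalization,
    ⟨Weihrauch.choiceNat_le_completion, Weihrauch.not_completion_le_choiceNat⟩,
    ⟨Weihrauch.completion_le_totalization,
      Weihrauch.limitComputable_completion.not_totalization_le⟩⟩
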